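/- Let $1\le k\le n$ be integers, let $e_r$ be the elementary symmetric polynomials in $x_1,\dots,x_n$, and put $I_{n,k}=\langle e_n,e_{n-1},\dots,e_{n-k+1},x_1^k,\dots,x_n^k\rangle\subseteq\mathbb C[x_1,\dots,x_n]$ and $R_{n,k}=\mathbb C[x_1,\dots,x_n]/I_{n,k}$. An $(n,k)$-staircase is a shuffle of $(k-1,k-2,\dots,1,0)$ with the sequence $(k-1,\dots,k-1)$ of length $n-k$. A sequence $(a_1,\dots,a_n)$ of nonnegative integers is $(n,k)$-substaircase if it is componentwise $\le$ some $(n,k)$-staircase, and $\mathcal A_{n,k}$ is the set of the monomials $x_1^{a_1}\cdots x_n^{a_n}$ with $(a_1,\dots,a_n)$ $(n,k)$-substaircase. The neglex term order is the lexicographic order with $x_n>\cdots>x_2>x_1$, that is, $x_1^{a_1}\cdots x_n^{a_n}<x_1^{b_1}\cdots x_n^{b_n}$ iff for some $i$ one has $a_i<b_i$ and $a_j=b_j$ for all $j>i$. For $f\ne0$ let $\mathrm{in}_<(f)$ be the largest monomial appearing in $f$. The standard monomials of $R_{n,k}$ are the monomials that do not lie in the ideal $\mathrm{in}_<(I_{n,k})=\langle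 \mathrm{in}_<(f): 0\ne f\in I_{n,k}\rangle$. For $S=\{s_1<\cdots<s_r\}\subseteq\{1,\dots,n\}$ the skip sequence $\gamma(S)=(\gamma_1,\dots,\gamma_n)$ has $\gamma_i=i-j+1$ if $i=s_j$ and $\gamma_i=0$ if $i\notin S$; write $\mathrm{rev}(\gamma(S))=(\gamma_n,\dots,\gamma_1)$. For a sequence $\gamma$ of $n$ nonnegative integers the Demazure character $\kappa_\gamma\in\mathbb Z[x_1,\dots,x_n]$ is $x_1^{\gamma_1}\cdots x_n^{\gamma_n}$ if $\gamma_1\ge\cdots\ge\gamma_n$, and $\kappa_\gamma=\pi_i(\kappa_{s_i\cdot\gamma})$ if $\gamma_i<\gamma_{i+1}$, where $s_i$ swaps the $i$-th and $(i+1)$-st entries (respectively variables) and $\pi_i(f)=\dfrac{x_if-x_{i+1}(s_i\cdot f)}{x_i-x_{i+1}}$. Then: 1. The images of the monomials in $\mathcal A_{n,k}$ span $R_{n,k}$ over $\mathbb C$. 2. The images of the neglex standard monomials of $R_{n,k}$ form a $\mathbb C$-basis of $R_{n,k}$ (the standard monomial basis), and every standard monomial belongs to $\mathcal A_{n,k}$.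 3. For every $S\subseteq\{1,\dots,n\}$ with $|S|=n-k+1$, the Demazure character $\kappa_{\mathrm{rev}(\gamma(S))}$ lies in the ideal $\langle e_n,e_{n-1},\dots,e_{n-k+1}\rangle$, both in $\mathbb Z[x_1,\dots,x_n]$ and in $\mathbb C[x_1,\dots,x_n]$, and its neglex leading term is the monomial $x^{\mathrm{rev}(\gamma(S))}$ with coefficient $1$. -/

import Mathlib

open MvPolynomial

noncomputable section

namespace Substaircase

/-! ### The ring `R_{n,k}`

The variables `x_1, …, x_n` are `X 0, …, X (n-1)`, indexed by `Fin n`. -/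

/-- The ideal `⟨e_n, e_{n-1}, …, e_{n-k+1}⟩` of `A[x_1, …, x_n]` (used for `1 ≤ k ≤ n`). -/
def elemIdeal (A : Type*) [CommRing A] (n k : ℕ) : Ideal (MvPolynomial (Fin n) A) :=
  Ideal.span {f | ∃ r : ℕ, n - k + 1 ≤ r ∧ r ≤ n ∧ f = esymm (Fin n) A r}

/-- The ideal `I_{n,k} = ⟨e_n, …, e_{n-k+1}, x_1^k, …, x_n^k⟩` of `ℂ[x_1, …, x_n]`. -/
def idealI (n k : ℕ) : Ideal (MvPolynomial (Fin n) ℂ) :=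
  Ideal.span ({f | ∃ r : ℕ, n - k + 1 ≤ r ∧ r ≤ n ∧ f = esymm (Fin n) ℂ r} ∪
    Set.range fun i : Fin n => (X i : MvPolynomial (Fin n) ℂ) ^ k)

/-- The ring `R_{n,k} = ℂ[x_1, …, x_n] / I_{n,k}`. -/
abbrev ringR (n k : ℕ) : Type := MvPolynomial (Fin n) ℂ ⧸ idealI n k

/-! ### Substaircase monomials -/

/-- The sequence `c` of length `n` is a shuffle of `a` (of length `r`) and `b` (of length `s`):
the positions `1, …, n` split into two complementary sets, along which `c` spells out, from left
to right, `a` and `b`. -/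
def IsShuffle {r s n : ℕ} (a : Fin r → ℕ) (b : Fin s → ℕ) (c : Fin n → ℕ) : Prop :=
  ∃ (f : Fin r → Fin n) (g : Fin s → Fin n), StrictMono f ∧ StrictMono g ∧
    IsCompl (Set.range f) (Set.range g) ∧ (∀ i, c (f i) = a i) ∧ (∀ j, c (g j) = b j)

/-- `(n,k)`-staircases: the shuffles of `(k-1, k-2, …, 1, 0)` with the constant sequence
`(k-1, …, k-1)` of length `n-k`. -/
def IsStaircase (n k : ℕ) (c : Fin n → ℕ) : Prop :=
  IsShuffle (fun i : Fin k => k - 1 - (i : ℕ)) (fun _ : Fin (n - k) => k - 1) c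

/-- The family `E_{n,k}` of `(n,k)`-substaircase sequences. -/
def substaircase (n k : ℕ) : Set (Fin n → ℕ) :=
  {c | ∃ t : Fin n → ℕ, IsStaircase n k t ∧ c ≤ t}

/-- The monomial `x_1^{a_1} ⋯ x_n^{a_n}`. -/
def mon (A : Type*) [CommRing A] {n : ℕ} (a : Fin n → ℕ) : MvPolynomial (Fin n) A :=
  ∏ i, X i ^ a i

/-- The set `A_{n,k}` of `(n,k)`-substaircase monomials. -/
def substaircaseMonomials (n k : ℕ) : Set (MvPolynomial (Fin n) ℂ) :=
  mon ℂ '' substaircase n k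

/-! ### The `neglex` order, initial ideals, standard monomials -/

/-- The `neglex` term order: the lexicographic order for `x_n > ⋯ > x_2 > x_1`. -/
def neglex (n : ℕ) : MonomialOrder (Fin n) where
  syn := Colex (Fin n →₀ ℕ)
  toSyn :=
    { toEquiv := toColex
      map_add' := fun _ _ => rfl }
  toSyn_monotone := Finsupp.toColex_monotone

open scoped MonomialOrder in
/-- The explicit description of `neglex`. -/
theorem neglex_lt_iff {n : ℕ} {a b : Fin n →₀ ℕ} :
    a ≺[neglex n] b ↔ ∃ i, a i < b i ∧ ∀ j, i < j → a j = b j := by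
  change toColex a < toColex b ↔ _
  rw [Finsupp.Colex.lt_iff]
  constructor <;> rintro ⟨i, h1, h2⟩ <;> exact ⟨i, h2, h1⟩

/-- The largest monomial appearing in `f` with respect to `neglex` (meaningful for `f ≠ 0`). -/
def initialMonomial {n : ℕ} (f : MvPolynomial (Fin n) ℂ) : MvPolynomial (Fin n) ℂ :=
  monomial ((neglex n).degree f) 1

/-- The initial ideal of `I` with respect to `neglex`. -/
def initialIdeal {n : ℕ} (I : Ideal (MvPolynomial (Fin n) ℂ)) : Ideal (MvPolynomial (Fin n) ℂ) :=
  Ideal.span {m | ∃ f ∈ I, f ≠ 0 ∧ m = initialMonomial f}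

/-- The `neglex` standard monomials of `I`: all monomials not contained in the initial ideal.
(Their images in the quotient by `I` are its standard monomial basis.) -/
def standardMonomials {n : ℕ} (I : Ideal (MvPolynomial (Fin n) ℂ)) :
    Set (MvPolynomial (Fin n) ℂ) :=
  {m | (∃ a : Fin n → ℕ, m = mon ℂ a) ∧ m ∉ initialIdeal I}

/-! ### Skip sequences -/

/-- The skip sequence `γ(S)` of `S = {s_1 < ⋯ < s_r} ⊆ [n]`. In terms of one-based indices,
`γ(S)_i = i - j + 1` if `i = s_j`, and `γ(S)_i = 0` if `i ∉ S`; here `i` is the one-based index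
`(p : ℕ) + 1`, and `j - 1` is the number of elements of `S` below `s_j`. -/
def skipSeq {n : ℕ} (S : Finset (Fin n)) (p : Fin n) : ℕ :=
  if p ∈ S then (p : ℕ) + 1 - (S.filter (· < p)).card else 0

/-- The reversal `(γ_n, …, γ_1)` of a sequence `(γ_1, …, γ_n)`. -/
def revSeq {n : ℕ} (γ : Fin n → ℕ) (p : Fin n) : ℕ := γ (Fin.rev p)

/-! ### Demazure characters -/

section Demazure

variable {A : Type*} [CommRing A] {n : ℕ}

/-- The action of the transposition of `x_i` and `x_j` on polynomials. -/
def swapVars (i j : Fin n) : MvPolynomial (Fin n) A ≃ₐ[A] MvPolynomial (Fin n) A :=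
  renameEquiv A (Equiv.swap i j)

theorem swapVars_X (i j k : Fin n) :
    swapVars i j (X k : MvPolynomial (Fin n) A) = X (Equiv.swap i j k) := by
  simp [swapVars]

theorem X_sub_X_dvd_sub_swapVars (i j : Fin n) (f : MvPolynomial (Fin n) A) :
    X i - X j ∣ f - swapVars i j f := by
  induction f using MvPolynomial.induction_on with
  | C a => simp [swapVars]
  | add p q hp hq =>
    have := dvd_add hp hq
    rw [map_add]
    convert this using 1
    ring
  | mul_X p k hp =>
    have hX : (X i - X j : MvPolynomial (Fin n) A) ∣ X k - X (Equiv.swap i j k) := by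
      by_cases h1 : k = i
      · subst h1; simp
      · by_cases h2 : k = j
        · subst h2
          rw [Equiv.swap_apply_right]
          exact ⟨-1, by ring⟩
        · rw [Equiv.swap_apply_of_ne_of_ne h1 h2]; simp
    rw [map_mul, swapVars_X]
    have := dvd_add (hp.mul_right (X k)) (hX.mul_left (swapVars i j p))
    convert this using 1
    ring

theorem isobaric_dvd (i j : Fin n) (f : MvPolynomial (Fin n) A) :
    X i - X j ∣ X i * f - X j * swapVars i j f := by
  have h := (X_sub_X_dvd_sub_swapVars i j f).mul_left (X j)
  have := dvd_add (Dvd.intro f rfl : (X i - X j : MvPolynomial (Fin n) A) ∣ (X i - X j) * f) h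
  convert this using 1
  ring

/-- The isobaric divided difference
`(x_i f - x_j (s · f)) / (x_i - x_j)`, where `s` swaps `x_i` and `x_j`. The operator `π_i` is
`isobaric i j` for the successor `j` of `i`. -/
def isobaric (i j : Fin n) (f : MvPolynomial (Fin n) A) : MvPolynomial (Fin n) A :=
  (isobaric_dvd i j f).choose

/-- `isobaric i j f` is the quotient that it is meant to be. -/
theorem isobaric_spec (i j : Fin n) (f : MvPolynomial (Fin n) A) :
    (X i - X j) * isobaric i j f = X i * f - X j * swapVars i j f :=
  (isobaric_dvd i j f).choose_spec.symm

/-- `i` and `j` are consecutive positions of `γ` with `γ_i < γ_j`. -/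
def IsAscent (γ : Fin n → ℕ) (i j : Fin n) : Prop := (i : ℕ) + 1 = j ∧ γ i < γ j

/-- The sequence `γ` with its `i`-th and `j`-th entries swapped. -/
def swapSeq (γ : Fin n → ℕ) (i j : Fin n) : Fin n → ℕ := γ ∘ Equiv.swap i j

theorem sum_swapSeq_lt {γ : Fin n → ℕ} {i j : Fin n} (h : IsAscent γ i j) :
    ∑ p : Fin n, (p : ℕ) * swapSeq γ i j p < ∑ p : Fin n, (p : ℕ) * γ p := by
  obtain ⟨h1, h2⟩ := h
  have hij : i ≠ j := by rintro rfl; omega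
  have e : ∀ δ : Fin n → ℕ, ∑ p : Fin n, (p : ℕ) * δ p
      = ∑ p ∈ (Finset.univ.erase i).erase j, (p : ℕ) * δ p + (j : ℕ) * δ j + (i : ℕ) * δ i := by
    intro δ
    rw [← Finset.sum_erase_add _ _ (Finset.mem_univ i),
      ← Finset.sum_erase_add (Finset.univ.erase i) _ (a := j) (by simp [hij.symm])]
  rw [e, e γ]
  have e2 : ∑ p ∈ (Finset.univ.erase i).erase j, (p : ℕ) * swapSeq γ i j p
      = ∑ p ∈ (Finset.univ.erase i).erase j, (p : ℕ) * γ p := by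
    refine Finset.sum_congr rfl fun p hp => ?_
    simp only [Finset.mem_erase, Finset.mem_univ, and_true] at hp
    simp [swapSeq, Equiv.swap_apply_of_ne_of_ne hp.2 hp.1]
  rw [e2]
  simp only [swapSeq, Function.comp, Equiv.swap_apply_left, Equiv.swap_apply_right]
  rw [← h1]
  nlinarith

variable (A) in
open Classical in
/-- The Demazure character (key polynomial) `κ_γ`: it is `x_1^{γ_1} ⋯ x_n^{γ_n}` if
`γ_1 ≥ ⋯ ≥ γ_n`, and `π_i (κ_{s_i · γ})` if `γ_i < γ_{i+1}`. The recursion is run along a chosen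
`i`; the result does not depend on that choice, see `demazure_of_isAscent`. -/
def demazure (γ : Fin n → ℕ) : MvPolynomial (Fin n) A :=
  if h : ∃ q : Fin n × Fin n, IsAscent γ q.1 q.2 then
    isobaric h.choose.1 h.choose.2 (demazure (swapSeq γ h.choose.1 h.choose.2))
  else mon A γ
termination_by ∑ p : Fin n, (p : ℕ) * γ p
decreasing_by exact sum_swapSeq_lt h.choose_spec

theorem demazure_of_antitone {γ : Fin n → ℕ} (h : Antitone γ) : demazure A γ = mon A γ := by
  rw [demazure, dif_neg]
  rintro ⟨⟨i, j⟩, h1, h2⟩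
  exact absurd (h (show i ≤ j from Fin.le_def.2 (by simp only at h1; omega))) (not_le.2 h2)

theorem swapVars_swapVars (i j : Fin n) (f : MvPolynomial (Fin n) A) :
    swapVars i j (swapVars i j f) = f := by
  simp only [swapVars, renameEquiv_apply, rename_rename]
  convert rename_id_apply f using 3
  funext x
  simp

theorem swapVars_braid {i j k : Fin n} (hij : i ≠ j) (hik : i ≠ k) (hjk : j ≠ k)
    (f : MvPolynomial (Fin n) A) :
    swapVars i j (swapVars j k (swapVars i j f)) =
      swapVars j k (swapVars i j (swapVars j k f)) := by
  simp only [swapVars, renameEquiv_apply, rename_rename]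
  congr 2
  funext x
  simp only [Function.comp, Equiv.swap_apply_def]
  grind

theorem swapVars_comm {i j k l : Fin n} (hik : i ≠ k) (hil : i ≠ l) (hjk : j ≠ k) (hjl : j ≠ l)
    (f : MvPolynomial (Fin n) A) :
    swapVars i j (swapVars k l f) = swapVars k l (swapVars i j f) := by
  simp only [swapVars, renameEquiv_apply, rename_rename]
  congr 2
  funext x
  simp only [Function.comp, Equiv.swap_apply_def]
  grind

theorem swapVars_isobaric (i j k l : Fin n) (f : MvPolynomial (Fin n) A) :
    (X (Equiv.swap k l i) - X (Equiv.swap k l j)) * swapVars k l (isobaric i j f) =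
      X (Equiv.swap k l i) * swapVars k l f -
        X (Equiv.swap k l j) * swapVars k l (swapVars i j f) := by
  have := congrArg (swapVars k l) (isobaric_spec i j f)
  simpa only [map_mul, map_sub, swapVars_X] using this

theorem swapVars_swapVars_isobaric (i j k l p q : Fin n) (f : MvPolynomial (Fin n) A) :
    (X (Equiv.swap p q (Equiv.swap k l i)) - X (Equiv.swap p q (Equiv.swap k l j))) *
        swapVars p q (swapVars k l (isobaric i j f)) =
      X (Equiv.swap p q (Equiv.swap k l i)) * swapVars p q (swapVars k l f) -
        X (Equiv.swap p q (Equiv.swap k l j)) *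
          swapVars p q (swapVars k l (swapVars i j f)) := by
  have := congrArg (swapVars p q) (swapVars_isobaric i j k l f)
  simpa only [map_mul, map_sub, swapVars_X] using this

section Domain

variable [IsDomain A]

theorem X_sub_X_ne_zero {i j : Fin n} (h : i ≠ j) : (X i - X j : MvPolynomial (Fin n) A) ≠ 0 :=
  fun e => h (X_injective (sub_eq_zero.1 e))

theorem swapVars_isobaric_self {i j : Fin n} (h : i ≠ j) (f : MvPolynomial (Fin n) A) :
    swapVars i j (isobaric i j f) = isobaric i j f := by
  have h1 := swapVars_isobaric i j i j f
  rw [Equiv.swap_apply_left, Equiv.swap_apply_right, swapVars_swapVars] at h1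
  have h2 := isobaric_spec i j f
  refine mul_left_cancel₀ (X_sub_X_ne_zero (A := A) h.symm) ?_
  linear_combination h1 + h2

/-- Isobaric divided differences at disjoint pairs commute. -/
theorem isobaric_comm {i j k l : Fin n} (hij : i ≠ j) (hkl : k ≠ l) (hik : i ≠ k) (hil : i ≠ l)
    (hjk : j ≠ k) (hjl : j ≠ l) (f : MvPolynomial (Fin n) A) :
    isobaric i j (isobaric k l f) = isobaric k l (isobaric i j f) := by
  have a1 := isobaric_spec i j (isobaric k l f)
  have a2 := isobaric_spec k l f
  have a3 := swapVars_isobaric k l i j f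
  have b1 := isobaric_spec k l (isobaric i j f)
  have b2 := isobaric_spec i j f
  have b3 := swapVars_isobaric i j k l f
  rw [Equiv.swap_apply_of_ne_of_ne hik.symm hjk.symm,
    Equiv.swap_apply_of_ne_of_ne hil.symm hjl.symm] at a3
  rw [Equiv.swap_apply_of_ne_of_ne hik hil, Equiv.swap_apply_of_ne_of_ne hjk hjl] at b3
  rw [swapVars_comm hik hil hjk hjl] at a3
  refine mul_left_cancel₀ (mul_ne_zero (X_sub_X_ne_zero (A := A) hij)
    (X_sub_X_ne_zero (A := A) hkl)) ?_
  linear_combination (X k - X l) * a1 + X i * a2 - X j * a3 - (X i - X j) * b1 - X k * b2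
    + X l * b3

/-- The braid relation for isobaric divided differences. -/
theorem isobaric_braid {i j k : Fin n} (hij : i ≠ j) (hik : i ≠ k) (hjk : j ≠ k)
    (f : MvPolynomial (Fin n) A) :
    isobaric i j (isobaric j k (isobaric i j f)) =
      isobaric j k (isobaric i j (isobaric j k f)) := by
  have a0 := isobaric_spec i j f
  have a1 := isobaric_spec j k (isobaric i j f)
  have a2 := isobaric_spec i j (isobaric j k (isobaric i j f))
  have a3 := swapVars_isobaric j k i j (isobaric i j f)
  have a4 := swapVars_isobaric i j j k f
  have a5 := swapVars_swapVars_isobaric i j j k i j f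
  have b0 := isobaric_spec j k f
  have b1 := isobaric_spec i j (isobaric j k f)
  have b2 := isobaric_spec j k (isobaric i j (isobaric j k f))
  have b3 := swapVars_isobaric i j j k (isobaric j k f)
  have b4 := swapVars_isobaric j k i j f
  have b5 := swapVars_swapVars_isobaric j k i j j k f
  rw [swapVars_isobaric_self hij] at a3
  rw [swapVars_isobaric_self hjk] at b3
  rw [← swapVars_braid hij hik hjk] at b5
  simp only [Equiv.swap_apply_left, Equiv.swap_apply_right,
    Equiv.swap_apply_of_ne_of_ne hij hik, Equiv.swap_apply_of_ne_of_ne hik.symm hjk.symm]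
    at a3 a4 a5 b3 b4 b5
  refine mul_left_cancel₀ (mul_ne_zero (mul_ne_zero (X_sub_X_ne_zero (A := A) hij)
    (X_sub_X_ne_zero (A := A) hik)) (X_sub_X_ne_zero (A := A) hjk)) ?_
  linear_combination (X i - X k) * (X j - X k) * a2 + X i * (X i - X k) * a1
    - X j * (X j - X k) * a3 + X i * X j * a0 - X i * X k * a4 + X j * X k * a5
    - (X i - X j) * (X i - X k) * b2 - X j * (X i - X k) * b1 + X k * (X i - X j) * b3
    - X i * X i * b0 + X j * X j * b4 - X k * X k * b5

/-- The defining recursion of Demazure characters holds for every `i` with `γ_i < γ_{i+1}`. -/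
theorem demazure_of_isAscent {γ : Fin n → ℕ} {i j : Fin n} (h : IsAscent γ i j) :
    demazure A γ = isobaric i j (demazure A (swapSeq γ i j)) := by
  induction hN : ∑ p : Fin n, (p : ℕ) * γ p using Nat.strong_induction_on generalizing γ i j with
  | _ N ih =>
  subst hN
  -- the recursion for smaller sequences
  have ih' : ∀ {i j : Fin n} {δ : Fin n → ℕ}, (∑ p : Fin n, (p : ℕ) * δ p <
      ∑ p : Fin n, (p : ℕ) * γ p) → IsAscent δ i j →
      demazure A δ = isobaric i j (demazure A (swapSeq δ i j)) :=
    fun hlt hd => ih _ hlt hd rfl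
  -- any two ascents give the same result
  have key : ∀ {i j k l : Fin n}, i < k → IsAscent γ i j → IsAscent γ k l →
      isobaric i j (demazure A (swapSeq γ i j)) = isobaric k l (demazure A (swapSeq γ k l)) := by
    intro i j k l hlt h h'
    obtain ⟨h1, h2⟩ := id h
    obtain ⟨h3, h4⟩ := id h'
    have hlt' : (i : ℕ) < k := hlt
    have hij : i ≠ j := fun e => by subst e; omega
    have hkl : k ≠ l := fun e => by subst e; omega
    have hik : i ≠ k := fun e => by subst e; omega
    have hil : i ≠ l := fun e => by subst e; omega
    have hjl : j ≠ l := fun e => by subst e; omega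
    have s1 := sum_swapSeq_lt h
    have s2 := sum_swapSeq_lt h'
    by_cases hjk : j = k
    · subst hjk
      have u1 : IsAscent (swapSeq γ i j) j l := ⟨h3, by
        simp only [swapSeq, Function.comp, Equiv.swap_apply_right,
          Equiv.swap_apply_of_ne_of_ne hil.symm hjl.symm]
        omega⟩
      have u2 : IsAscent (swapSeq (swapSeq γ i j) j l) i j := ⟨h1, by
        simp only [swapSeq, Function.comp, Equiv.swap_apply_left,
          Equiv.swap_apply_of_ne_of_ne hij hil, Equiv.swap_apply_of_ne_of_ne hil.symm hjl.symm]
        omega⟩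
      have v1 : IsAscent (swapSeq γ j l) i j := ⟨h1, by
        simp only [swapSeq, Function.comp, Equiv.swap_apply_left,
          Equiv.swap_apply_of_ne_of_ne hij hil]
        omega⟩
      have v2 : IsAscent (swapSeq (swapSeq γ j l) i j) j l := ⟨h3, by
        simp only [swapSeq, Function.comp, Equiv.swap_apply_right,
          Equiv.swap_apply_of_ne_of_ne hij hil, Equiv.swap_apply_of_ne_of_ne hil.symm hjl.symm]
        omega⟩
      rw [ih' s1 u1, ih' ((sum_swapSeq_lt u1).trans s1) u2, ih' s2 v1,
        ih' ((sum_swapSeq_lt v1).trans s2) v2, isobaric_braid hij hil hjl]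
      congr 4
      funext x
      simp only [swapSeq, Function.comp, Equiv.swap_apply_def]
      grind
    · have u1 : IsAscent (swapSeq γ i j) k l := ⟨h3, by
        simp only [swapSeq, Function.comp, Equiv.swap_apply_of_ne_of_ne hik.symm (Ne.symm hjk),
          Equiv.swap_apply_of_ne_of_ne hil.symm hjl.symm]
        omega⟩
      have v1 : IsAscent (swapSeq γ k l) i j := ⟨h1, by
        simp only [swapSeq, Function.comp, Equiv.swap_apply_of_ne_of_ne hik hil,
          Equiv.swap_apply_of_ne_of_ne hjk hjl]
        omega⟩
      rw [ih' s1 u1, ih' s2 v1, isobaric_comm hij hkl hik hil hjk hjl]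
      congr 3
      funext x
      simp only [swapSeq, Function.comp, Equiv.swap_apply_def]
      grind
  have hex : ∃ q : Fin n × Fin n, IsAscent γ q.1 q.2 := ⟨(i, j), h⟩
  rw [demazure, dif_pos hex]
  have hc := hex.choose_spec
  rcases lt_trichotomy hex.choose.1 i with hlt | heq | hgt
  · exact key hlt hc h
  · have e2 : hex.choose.2 = j := Fin.ext (by rw [← hc.1, ← h.1, heq])
    rw [heq, e2]
  · exact (key hgt h hc).symm

end Domain

end Demazure

end Substaircase

end

open Substaircase

/-! Standard monomials of any ideal form a basis of the quotient, by division with remainder. So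
everything reduces to showing that a monomial `x^a` that is not substaircase is divisible by the
leading monomial of some element of `idealI n k`. If some `a_p ≥ k`, then `x_p^k` serves. Otherwise
a greedy attempt to fit a staircase over `a`, scanning from the right, fails, and the rejected
positions contain a set `S` of size `n-k+1` with `rev(γ(S)) ≤ a`
(`exists_skip_le_of_notMem_substaircase`).

It remains to understand the Demazure character of `rev(γ(S))`. Its non-zero entries `l_i`, at
positions `t_i`, weakly decrease, so it is a flagged Schur polynomial `det h_{l_i-i+j}(x_q : q ≤
t_i)` (`demazure_eq_det_flaggedMatrix`): isobaric operators enlarge the flag one row at a time,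
starting from a monomial. Multiplying the matrix by a column of signed elementary polynomials, and
using Cramer's rule, puts the determinant in the ideal (`det_flaggedMatrix_mem`). In its expansion
the diagonal dominates for `neglex` (`leading_det_flaggedMatrix`). -/

namespace Substaircase

/-! ### Generating series of elementary and complete homogeneous polynomials -/

section PowerSeries

variable {R : Type*} [CommRing R] {ι : Type*}

/-- The geometric series `1 / (1 - a T)`. -/
noncomputable def geomSeries (a : R) : PowerSeries R := PowerSeries.mk fun d => a ^ d

/-- The polynomial `1 - a T`, as a power series. -/
noncomputable def oneSub (a : R) : PowerSeries R := 1 + PowerSeries.C (-a) * PowerSeries.X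

theorem oneSub_mul_geomSeries (a : R) : oneSub a * geomSeries a = 1 := by
  ext d
  rw [oneSub, add_mul, one_mul, mul_assoc, map_add, PowerSeries.coeff_C_mul]
  cases d with
  | zero => simp [geomSeries]
  | succ d => simp [geomSeries, PowerSeries.coeff_succ_X_mul, PowerSeries.coeff_one, pow_succ']

theorem coeff_prod_oneSub (s : Finset ι) (f : ι → R) (d : ℕ) :
    PowerSeries.coeff d (∏ i ∈ s, oneSub (f i)) =
      (-1) ^ d * ∑ u ∈ s.powersetCard d, ∏ i ∈ u, f i := by
  have h : ∀ u ∈ s.powerset, PowerSeries.coeff d (∏ i ∈ u, PowerSeries.C (-f i) * PowerSeries.X) =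
      if u.card = d then (-1) ^ d * ∏ i ∈ u, f i else 0 := by
    intro u _
    rw [Finset.prod_mul_distrib, Finset.prod_const, ← map_prod, PowerSeries.coeff_C_mul,
      PowerSeries.coeff_X_pow, Finset.prod_neg]
    by_cases hd : u.card = d
    · simp [hd]
    · simp [hd, Ne.symm hd]
  simp only [oneSub]
  rw [Finset.prod_one_add, map_sum, Finset.sum_congr rfl h, ← Finset.sum_filter,
    ← Finset.powersetCard_eq_filter, Finset.mul_sum]

theorem coeff_prod_oneSub_eq_zero {s : Finset ι} {d : ℕ} (h : s.card < d) (f : ι → R) :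
    PowerSeries.coeff d (∏ i ∈ s, oneSub (f i)) = 0 := by
  rw [coeff_prod_oneSub, Finset.powersetCard_eq_empty.2 h]
  simp

/-- Partial fractions; this is the source of the action of divided differences on complete
homogeneous polynomials. -/
theorem sub_mul_geomSeries (a b : R) :
    PowerSeries.C (a - b) * (geomSeries a * geomSeries b) =
      PowerSeries.C a * geomSeries a - PowerSeries.C b * geomSeries b := by
  have ha := oneSub_mul_geomSeries a
  have hb := oneSub_mul_geomSeries b
  simp only [oneSub, map_neg] at ha hb
  rw [map_sub]
  linear_combination (-PowerSeries.C b * geomSeries b) * ha + (PowerSeries.C a * geomSeries a) * hb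

theorem coeff_prod_geomSeries_mem {A : Type*} [CommSemiring A] [Algebra A R]
    (B : Subalgebra A R) (s : Finset ι) (f : ι → R) (hf : ∀ i ∈ s, f i ∈ B) (d : ℕ) :
    PowerSeries.coeff d (∏ i ∈ s, geomSeries (f i)) ∈ B := by
  classical
  induction s using Finset.induction_on generalizing d with
  | empty =>
    rw [Finset.prod_empty, PowerSeries.coeff_one]
    split_ifs
    · exact B.one_mem
    · exact B.zero_mem
  | insert i s hi ih =>
    rw [Finset.prod_insert hi, PowerSeries.coeff_mul]
    refine B.sum_mem fun p _ => B.mul_mem ?_ (ih (fun j hj => hf j (Finset.mem_insert_of_mem hj)) _)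
    rw [geomSeries, PowerSeries.coeff_mk]
    exact B.pow_mem (hf i (Finset.mem_insert_self _ _)) _

theorem map_geomSeries {S : Type*} [CommRing S] (φ : R →+* S) (a : R) :
    PowerSeries.map φ (geomSeries a) = geomSeries (φ a) := by
  ext d
  simp [geomSeries]

/-- In the Cauchy product, the terms omitted from the sum involve only coefficients of `E` above
degree `m`. The sum is a matrix row times a column, so products with Jacobi–Trudi matrices can be
read off from power series: exactly for `I = ⊥`, and otherwise modulo `I`. -/
theorem coeff_mul_sub_sum_mem (I : Ideal R) (F E : PowerSeries R) {m r : ℕ} (c : ℕ) (hm : m < r)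
    (hE : ∀ d, m < d → PowerSeries.coeff d E ∈ I) :
    PowerSeries.coeff (c + m) (F * E) -
      ∑ j : Fin r, PowerSeries.coeff (c + j) F *
        (if (j : ℕ) ≤ m then PowerSeries.coeff (m - j) E else 0) ∈ I := by
  obtain ⟨s, rfl⟩ : ∃ s, r = m + 1 + s := ⟨r - (m + 1), by omega⟩
  rw [Fin.sum_univ_eq_sum_range (fun j => PowerSeries.coeff (c + j) F *
        (if j ≤ m then PowerSeries.coeff (m - j) E else 0)) (m + 1 + s),
    PowerSeries.coeff_mul, Finset.Nat.sum_antidiagonal_eq_sum_range_succ_mk,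
    show (c + m).succ = c + (m + 1) from rfl, Finset.sum_range_add _ c,
    Finset.sum_range_add _ (m + 1)]
  have h1 : ∑ x ∈ Finset.range s, PowerSeries.coeff (c + (m + 1 + x)) F *
      (if m + 1 + x ≤ m then PowerSeries.coeff (m - (m + 1 + x)) E else 0) = 0 :=
    Finset.sum_eq_zero fun x _ => by rw [if_neg (by omega), mul_zero]
  have h2 : ∑ x ∈ Finset.range (m + 1), PowerSeries.coeff (c + x) F *
      (if x ≤ m then PowerSeries.coeff (m - x) E else 0) =
      ∑ x ∈ Finset.range (m + 1), PowerSeries.coeff (c + x) F *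
        PowerSeries.coeff (c + m - (c + x)) E :=
    Finset.sum_congr rfl fun x hx => by
      rw [if_pos (by simpa [Nat.lt_succ_iff] using hx), Nat.add_sub_add_left]
  rw [h1, h2, add_zero, add_sub_cancel_right]
  refine I.sum_mem fun x hx => I.mul_mem_left _ (hE _ ?_)
  have := Finset.mem_range.1 hx
  omega

end PowerSeries

/-! ### Flagged Schur polynomials as Jacobi–Trudi determinants -/

section Flagged

variable {A : Type*} [CommRing A] {n r : ℕ}

/-- The generating function of the complete homogeneous polynomials in the variables `x_q`,
`q ≤ m`. -/
noncomputable def completeSeries (A : Type*) [CommRing A] {n : ℕ} (m : Fin n) :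
    PowerSeries (MvPolynomial (Fin n) A) :=
  ∏ q ∈ Finset.Iic m, geomSeries (X q)

/-- The Jacobi–Trudi matrix `(h_{l_i - i + j}(x_q : q ≤ t_i))` of a flagged Schur polynomial. -/
noncomputable def flaggedMatrix (A : Type*) [CommRing A] {n r : ℕ} (t : Fin r → Fin n)
    (l : Fin r → ℕ) : Matrix (Fin r) (Fin r) (MvPolynomial (Fin n) A) :=
  Matrix.of fun i j =>
    PowerSeries.coeff (l i + j) (PowerSeries.X ^ (i : ℕ) * completeSeries A (t i))

theorem completeSeries_mul_prod_oneSub {s : Finset (Fin n)} {m : Fin n} (h : Finset.Iic m ⊆ s) :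
    completeSeries A m * ∏ q ∈ s, oneSub (X q) = ∏ q ∈ s \ Finset.Iic m, oneSub (X q) := by
  rw [← Finset.prod_sdiff h, mul_left_comm, completeSeries, ← Finset.prod_mul_distrib]
  simp [mul_comm (geomSeries _), oneSub_mul_geomSeries]

theorem prod_oneSub_mul_completeSeries {m : Fin n} :
    (∏ q ∈ Finset.Iio m, oneSub (X q)) * completeSeries A m = geomSeries (X m) := by
  rw [completeSeries, ← Finset.Iio_insert, Finset.prod_insert (by simp), mul_left_comm,
    ← Finset.prod_mul_distrib]
  simp [oneSub_mul_geomSeries]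

theorem completeSeries_mul_prod_oneSub_Iio {m p : Fin n} (h : m < p) :
    completeSeries A m * ∏ q ∈ Finset.Iio p, oneSub (X q) =
      ∏ q ∈ Finset.Ioo m p, oneSub (X q) := by
  rw [completeSeries_mul_prod_oneSub]
  · congr 1
    ext q
    simp [and_comm]
  · intro q hq
    simp only [Finset.mem_Iic, Finset.mem_Iio] at *
    exact hq.trans_lt h

/-- For the flag `1, 2, …, r` the flagged Schur polynomial is a monomial. -/
theorem det_flaggedMatrix_of_eq {t : Fin r → Fin n} (ht : ∀ i, (t i : ℕ) = i) {l : Fin r → ℕ}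
    (hl : ∀ i, 0 < l i) : (flaggedMatrix A t l).det = ∏ i, X (t i) ^ l i := by
  have hrel : ∀ i j : Fin r, t i < t j ↔ i < j := fun i j => by
    rw [Fin.lt_def, Fin.lt_def, ht, ht]
  -- Column `m` of this unitriangular matrix holds the coefficients of `∏_{q < t_m} (1 - x_q T)`.
  -- The product with the flagged matrix is lower triangular: for `i < m` its entry has degree `l_i
  -- + m - i` in a product of only `m - i - 1` linear factors. The diagonal entries are coefficients
  -- of `1 / (1 - x_{t_i} T)`.
  let U : Matrix (Fin r) (Fin r) (MvPolynomial (Fin n) A) := Matrix.of fun j m =>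
    if (j : ℕ) ≤ m then PowerSeries.coeff (m - j) (∏ q ∈ Finset.Iio (t m), oneSub (X q)) else 0
  have hU : U.det = 1 := by
    rw [Matrix.det_of_isUpperTriangular]
    · refine Finset.prod_eq_one fun i _ => ?_
      simp [U, coeff_prod_oneSub]
    · intro i j hij
      exact if_neg (not_le.2 hij)
  have hM : ∀ i m, (flaggedMatrix A t l * U) i m = PowerSeries.coeff (l i + m)
      (PowerSeries.X ^ (i : ℕ) * completeSeries A (t i) * ∏ q ∈ Finset.Iio (t m), oneSub (X q)) := by
    intro i m
    have := coeff_mul_sub_sum_mem (R := MvPolynomial (Fin n) A) ⊥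
      (PowerSeries.X ^ (i : ℕ) * completeSeries A (t i)) (∏ q ∈ Finset.Iio (t m), oneSub (X q))
      (l i) m.2 (fun d hd => by
        rw [coeff_prod_oneSub_eq_zero]
        · exact Ideal.zero_mem _
        · simpa [ht] using hd)
    rw [Ideal.mem_bot, sub_eq_zero] at this
    rw [this, Matrix.mul_apply]
    rfl
  have hd : (flaggedMatrix A t l * U).det = ∏ i, X (t i) ^ l i := by
    rw [Matrix.det_of_isLowerTriangular]
    · refine Finset.prod_congr rfl fun i _ => ?_
      rw [hM, mul_assoc, mul_comm (completeSeries A (t i)), prod_oneSub_mul_completeSeries,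
        PowerSeries.coeff_X_pow_mul, geomSeries, PowerSeries.coeff_mk]
    · intro i j hij
      have hij' : i < j := hij
      rw [hM, mul_assoc, completeSeries_mul_prod_oneSub_Iio ((hrel i j).2 hij'),
        PowerSeries.coeff_X_pow_mul']
      have := hl i
      rw [if_pos (by rw [Fin.lt_def] at hij'; omega), coeff_prod_oneSub_eq_zero]
      rw [Fin.card_Ioo, ht, ht]
      rw [Fin.lt_def] at hij'
      omega
  rw [Matrix.det_mul, hU, mul_one] at hd
  exact hd

/-- If `l_i - 1` is the number of positions to the right of `t_i` outside the range of `t`, then the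
flagged Schur polynomial lies in the ideal generated by the `e_d` with `d ≥ r`. -/
theorem det_flaggedMatrix_mem (I : Ideal (MvPolynomial (Fin n) A))
    (hI : ∀ d, r ≤ d → d ≤ n → esymm (Fin n) A d ∈ I) (hr : 0 < r) {t : Fin r → Fin n}
    {l : Fin r → ℕ} (hl : ∀ i, n + i ≤ l i + r - 1 + t i) :
    (flaggedMatrix A t l).det ∈ I := by
  obtain ⟨r, rfl⟩ : ∃ s, r = s + 1 := ⟨r - 1, by omega⟩
  let E : PowerSeries (MvPolynomial (Fin n) A) := ∏ q, oneSub (X q)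
  have hE : ∀ d, r < d → PowerSeries.coeff d E ∈ I := by
    intro d hd
    by_cases hdn : d ≤ n
    · rw [coeff_prod_oneSub]
      exact I.mul_mem_left _ (hI d hd hdn)
    · rw [coeff_prod_oneSub_eq_zero]
      · exact I.zero_mem
      · simpa using hdn
  -- The matrix now has size `r + 1`, and the coefficients of `E` above degree `r` lie in `I`. The
  -- test `j ≤ r` always succeeds; it only matches the shape of `coeff_mul_sub_sum_mem`.
  let v : Fin (r + 1) → MvPolynomial (Fin n) A := fun j =>
    if (j : ℕ) ≤ r then PowerSeries.coeff (r - j) E else 0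
  -- Modulo `I` this is the coefficient of degree `l_i + r - i` in the product of `1 - x_q T` over
  -- `q > t_i`. By `hl` that degree exceeds the number `n - 1 - t_i` of factors.
  have hMv : ∀ i, ((flaggedMatrix A t l).mulVec v) i ∈ I := by
    intro i
    have h := coeff_mul_sub_sum_mem I (PowerSeries.X ^ (i : ℕ) * completeSeries A (t i)) E (l i)
      (Nat.lt_succ_self r) hE
    rw [mul_assoc, completeSeries_mul_prod_oneSub (Finset.subset_univ _),
      PowerSeries.coeff_X_pow_mul'] at h
    have := hl i
    have := i.2
    rw [coeff_prod_oneSub_eq_zero, ite_self, zero_sub, neg_mem_iff] at h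
    · exact h
    · rw [← Finset.compl_eq_univ_sdiff, Finset.card_compl, Fin.card_Iic, Fintype.card_fin]
      omega
  -- Cramer's rule: `det • v` has entries in `I`, and the last entry of `v` is the constant term `1`
  -- of `E`.
  have hdet : (flaggedMatrix A t l).det • v =
      (flaggedMatrix A t l).adjugate.mulVec ((flaggedMatrix A t l).mulVec v) := by
    rw [Matrix.mulVec_mulVec, Matrix.adjugate_mul, Matrix.smul_mulVec, Matrix.one_mulVec]
  have hlast := congrFun hdet (Fin.last r)
  have hv : v (Fin.last r) = 1 := by simp [v, E, coeff_prod_oneSub]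
  rw [Pi.smul_apply, hv, smul_eq_mul, mul_one] at hlast
  rw [hlast, Matrix.mulVec, dotProduct]
  exact I.sum_mem fun j _ =>
    I.mul_mem_left ((flaggedMatrix A t l).adjugate (Fin.last r) j) (hMv j)

/-- The transposition of two variables, as a ring homomorphism. -/
noncomputable def swapHom (A : Type*) [CommRing A] {n : ℕ} (p q : Fin n) :
    MvPolynomial (Fin n) A →+* MvPolynomial (Fin n) A :=
  RingHomClass.toRingHom (swapVars (A := A) p q)

theorem swapHom_apply (p q : Fin n) (f : MvPolynomial (Fin n) A) :
    swapHom A p q f = swapVars p q f := rfl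

theorem map_swapHom_prod_geomSeries {p q : Fin n} {s : Finset (Fin n)}
    (hs : p ∈ s ↔ q ∈ s) :
    PowerSeries.map (swapHom A p q) (∏ a ∈ s, geomSeries (X a)) = ∏ a ∈ s, geomSeries (X a) := by
  rw [map_prod]
  refine Finset.prod_equiv (Equiv.swap p q) (fun a => ?_) (fun a _ => ?_)
  · rw [Equiv.swap_apply_def]
    split_ifs <;> simp_all
  · rw [map_geomSeries, swapHom_apply, swapVars_X]

theorem map_swapHom_completeSeries {p q m : Fin n} (hpq : (p : ℕ) + 1 = q) (hm : m ≠ p) :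
    PowerSeries.map (swapHom A p q) (completeSeries A m) = completeSeries A m := by
  refine map_swapHom_prod_geomSeries ?_
  simp only [Finset.mem_Iic, Fin.le_def, ne_eq, Fin.ext_iff] at *
  omega

/-- The variables before `x_p` give a common symmetric factor, so this is `sub_mul_geomSeries` for
`x_p` and `x_q`. It says that `π_p` adjoins one variable to every `h_d(x_1, …, x_p)`. -/
theorem sub_mul_completeSeries {p q : Fin n} (hpq : (p : ℕ) + 1 = q) :
    PowerSeries.C (X p - X q) * completeSeries A q =
      PowerSeries.C (X p) * completeSeries A p -
        PowerSeries.C (X q) * PowerSeries.map (swapHom A p q) (completeSeries A p) := by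
  have h1 : completeSeries A p = geomSeries (X p) * ∏ a ∈ Finset.Iio p, geomSeries (X a) := by
    rw [completeSeries, ← Finset.Iio_insert, Finset.prod_insert (by simp)]
  have h2 : completeSeries A q =
      geomSeries (X q) * (geomSeries (X p) * ∏ a ∈ Finset.Iio p, geomSeries (X a)) := by
    have : Finset.Iio q = Finset.Iic p := by
      ext a
      simp only [Finset.mem_Iio, Finset.mem_Iic, Fin.lt_def, Fin.le_def]
      omega
    rw [← h1, completeSeries, ← Finset.Iio_insert, Finset.prod_insert (by simp), this]
    rfl
  have h3 : PowerSeries.map (swapHom A p q) (∏ a ∈ Finset.Iio p, geomSeries (X a)) =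
      ∏ a ∈ Finset.Iio p, geomSeries (X a) := by
    refine map_swapHom_prod_geomSeries ?_
    simp only [Finset.mem_Iio, Fin.lt_def]
    omega
  rw [h1, h2, map_mul, h3, map_geomSeries, swapHom_apply, swapVars_X, Equiv.swap_apply_left]
  linear_combination (∏ a ∈ Finset.Iio p, geomSeries (X a)) *
    sub_mul_geomSeries (X p : MvPolynomial (Fin n) A) (X q)

theorem flaggedMatrix_row_update {p q : Fin n} (hpq : (p : ℕ) + 1 = q) (l : Fin r → ℕ)
    (i j : Fin r) :
    (X p - X q) * PowerSeries.coeff (l i + j) (PowerSeries.X ^ (i : ℕ) * completeSeries A q) =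
      X p * PowerSeries.coeff (l i + j) (PowerSeries.X ^ (i : ℕ) * completeSeries A p) -
      X q * swapHom A p q
        (PowerSeries.coeff (l i + j) (PowerSeries.X ^ (i : ℕ) * completeSeries A p)) := by
  have hmap : PowerSeries.map (swapHom A p q) (PowerSeries.X ^ (i : ℕ) * completeSeries A p) =
      PowerSeries.X ^ (i : ℕ) * PowerSeries.map (swapHom A p q) (completeSeries A p) := by
    rw [map_mul, map_pow, PowerSeries.map_X]
  rw [← PowerSeries.coeff_map, ← PowerSeries.coeff_C_mul, ← PowerSeries.coeff_C_mul,
    ← PowerSeries.coeff_C_mul, ← map_sub, mul_left_comm, sub_mul_completeSeries hpq, hmap]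
  congr 1
  ring

/-- Isobaric divided differences move the flag of a flagged Schur polynomial. -/
theorem isobaric_det_flaggedMatrix [IsDomain A] {p q : Fin n} (hpq : (p : ℕ) + 1 = q)
    {t : Fin r → Fin n} (hp : ∀ i, t i ≠ p) {i₀ : Fin r} (hq : ∀ i, t i = q ↔ i = i₀)
    (l : Fin r → ℕ) :
    isobaric p q (flaggedMatrix A (Function.update t i₀ p) l).det = (flaggedMatrix A t l).det := by
  have hne : p ≠ q := fun e => by subst e; omega
  -- Every row other than `i₀` uses both or neither of `x_p`, `x_q` and is fixed by the swap. By
  -- linearity of the determinant in row `i₀`, the operator acts on that row alone.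
  refine mul_left_cancel₀ (X_sub_X_ne_zero (A := A) hne) ?_
  rw [isobaric_spec, ← swapHom_apply, RingHom.map_det]
  let M := flaggedMatrix A t l
  let row : Fin r → MvPolynomial (Fin n) A := flaggedMatrix A (Function.update t i₀ p) l i₀
  have h0 : M.updateRow i₀ (M i₀) = M := Matrix.updateRow_eq_self _ _
  have h1 : flaggedMatrix A (Function.update t i₀ p) l = M.updateRow i₀ row := by
    ext1 i j
    by_cases h : i = i₀
    · subst h; simp [row]
    · simp [Matrix.updateRow_ne h, M, flaggedMatrix, Function.update_of_ne h]
  have h2 : (swapHom A p q).mapMatrix (M.updateRow i₀ row) =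
      M.updateRow i₀ (swapHom A p q ∘ row) := by
    ext1 i j
    by_cases h : i = i₀
    · subst h; simp
    · simp only [RingHom.mapMatrix_apply, Matrix.map_apply, Matrix.updateRow_ne h, M,
        flaggedMatrix, Matrix.of_apply]
      rw [← PowerSeries.coeff_map, map_mul, map_pow, PowerSeries.map_X,
        map_swapHom_completeSeries hpq (hp i)]
  have h3 : (X p - X q : MvPolynomial (Fin n) A) • M i₀ =
      (X p : MvPolynomial (Fin n) A) • row + (-X q : MvPolynomial (Fin n) A) • (swapHom A p q ∘ row) := by
    funext j
    have := flaggedMatrix_row_update (A := A) hpq l i₀ j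
    simp only [Pi.smul_apply, Pi.add_apply, smul_eq_mul, Function.comp, M, row, flaggedMatrix,
      Matrix.of_apply, Function.update_self, (hq i₀).2 rfl]
    rw [this]
    ring
  have h4 := congrArg (fun v => (M.updateRow i₀ v).det) h3
  simp only [Matrix.det_updateRow_add, Matrix.det_updateRow_smul, h0] at h4
  rw [h1, h2, h4]
  ring

theorem val_add_le_of_strictMono {s : Fin r → Fin n} (hs : StrictMono s) {i j : Fin r}
    (hij : i ≤ j) : (s i : ℕ) + j ≤ s j + i := by
  obtain ⟨j, hj⟩ := j
  induction j with
  | zero =>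
    obtain rfl : i = ⟨0, hj⟩ := Fin.ext (Nat.le_zero.1 (Fin.le_def.1 hij))
    exact le_rfl
  | succ j ih =>
    rcases eq_or_lt_of_le hij with h | h
    · subst h; exact le_rfl
    · have h1 := ih (Nat.lt_of_succ_lt hj) (Fin.le_def.2 (Nat.lt_succ_iff.1 (Fin.lt_def.1 h)))
      have h2 : s ⟨j, Nat.lt_of_succ_lt hj⟩ < s ⟨j + 1, hj⟩ :=
        hs (Fin.lt_def.2 (Nat.lt_succ_self j))
      rw [Fin.lt_def] at h2
      simp only at h1 ⊢
      omega

/-- Demazure characters whose non-zero entries decrease are flagged Schur polynomials. -/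
theorem demazure_eq_det_flaggedMatrix [IsDomain A] {t : Fin r → Fin n} (ht : StrictMono t)
    {l : Fin r → ℕ} (hl : ∀ i, 0 < l i) (hl' : Antitone l) {γ : Fin n → ℕ}
    (hγ : ∀ i, γ (t i) = l i) (hγ' : ∀ p, (∀ i, t i ≠ p) → γ p = 0) :
    demazure A γ = (flaggedMatrix A t l).det := by
  induction hN : ∑ p : Fin n, (p : ℕ) * γ p using Nat.strong_induction_on generalizing γ t with
  | _ N ih =>
  subst hN
  have hle : ∀ i : Fin r, (i : ℕ) ≤ t i := fun i => by
    have := val_add_le_of_strictMono ht (i := ⟨0, i.pos⟩) (j := i) (Fin.le_def.2 (Nat.zero_le _))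
    simp only at this
    omega
  by_cases hbase : ∀ i, (t i : ℕ) = i
  · rw [det_flaggedMatrix_of_eq hbase hl, demazure_of_antitone, mon]
    · rw [← Finset.prod_subset (Finset.subset_univ (Finset.univ.image t)),
        Finset.prod_image ht.injective.injOn]
      · simp [hγ]
      · intro p _ hp
        rw [hγ' p, pow_zero]
        simpa using hp
    · intro p q hpq
      by_cases hq : ∀ i, t i ≠ q
      · rw [hγ' q hq]; exact Nat.zero_le _
      · push Not at hq
        obtain ⟨j, rfl⟩ := hq
        have hp : t ⟨p, lt_of_le_of_lt (Fin.le_def.1 hpq) (by rw [hbase]; exact j.2)⟩ = p :=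
          Fin.ext (hbase _)
        rw [hγ, ← hp, hγ]
        apply hl'
        rw [Fin.le_def, hbase] at hpq
        exact hpq
  · push Not at hbase
    -- For the first `i₀` with `t_{i₀} ≠ i₀`, the position just before `t_{i₀}` is empty. This gives
    -- an ascent `0 < l_{i₀}`, and the swap moves that entry one step left, leaving the order of the
    -- non-zero entries unchanged.
    obtain ⟨i₀, hi₀, hmin⟩ := WellFounded.has_min (r := ((· < ·) : Fin r → Fin r → Prop))
      wellFounded_lt {i | (t i : ℕ) ≠ i} hbase
    have hlt : (i₀ : ℕ) < t i₀ := lt_of_le_of_ne (hle i₀) (Ne.symm hi₀)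
    have hbelow : ∀ i < i₀, (t i : ℕ) = i := fun i hi => by
      by_contra h
      exact hmin i h hi
    let p : Fin n := ⟨(t i₀ : ℕ) - 1, lt_of_le_of_lt (Nat.sub_le _ _) (t i₀).2⟩
    have hpv : (p : ℕ) = t i₀ - 1 := rfl
    have hpq : (p : ℕ) + 1 = t i₀ := by omega
    have hp : ∀ i, t i ≠ p := by
      intro i h
      have h' := congrArg Fin.val h
      rcases lt_or_ge i i₀ with hi | hi
      · have h1 := hbelow i hi
        rw [Fin.lt_def] at hi
        omega
      · have h1 := Fin.le_def.1 (ht.monotone hi)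
        omega
    have hasc : IsAscent γ p (t i₀) := ⟨hpq, by rw [hγ' p hp, hγ]; exact hl i₀⟩
    rw [demazure_of_isAscent hasc,
      ← isobaric_det_flaggedMatrix hpq hp (i₀ := i₀) (fun i => ht.injective.eq_iff)]
    congr 1
    have hne : p ≠ t i₀ := (hp i₀).symm
    refine ih _ (sum_swapSeq_lt hasc) ?_ ?_ ?_ rfl
    · intro i j hij
      have h1 := ht hij
      have h2 := hp i
      rw [Fin.lt_def] at h1 ⊢
      simp only [ne_eq, Fin.ext_iff] at h2
      rw [Function.update_apply, Function.update_apply]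
      split_ifs with hi hj hj
      · exact absurd (hi.trans hj.symm) hij.ne
      · subst hi; omega
      · subst hj; omega
      · exact h1
    · intro i
      by_cases h : i = i₀
      · subst h
        simp [swapSeq, hγ]
      · rw [Function.update_of_ne h, swapSeq, Function.comp,
          Equiv.swap_apply_of_ne_of_ne (hp i) (ht.injective.ne h), hγ]
    · intro a ha
      have h0 := ha i₀
      rw [Function.update_self] at h0
      by_cases haq : a = t i₀
      · subst haq
        rw [swapSeq, Function.comp, Equiv.swap_apply_right, hγ' p hp]
      · rw [swapSeq, Function.comp, Equiv.swap_apply_of_ne_of_ne h0.symm haq]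
        refine hγ' a fun i hi => ?_
        by_cases h : i = i₀
        · subst h; exact haq hi.symm
        · have := ha i
          rw [Function.update_of_ne h] at this
          exact this hi

end Flagged

/-! ### Leading terms for `neglex` -/

section LeadingTerm

open scoped MonomialOrder

variable {A : Type*} [CommRing A] {n r : ℕ}

/-- Bounding the support of `g` rather than its degree admits `g = 0` even when `δ = 0`. -/
theorem leading_add_of_support_lt [Nontrivial A] (o : MonomialOrder (Fin n))
    {f g : MvPolynomial (Fin n) A} {δ : Fin n →₀ ℕ} (hf : o.Monic f) (hδ : o.degree f = δ)
    (hg : ∀ b ∈ g.support, b ≺[o] δ) : o.Monic (f + g) ∧ o.degree (f + g) = δ := by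
  subst hδ
  by_cases h : g = 0
  · subst h
    simpa using hf
  · have hlt := hg _ (o.degree_mem_support h)
    exact ⟨hf.add_of_lt hlt, o.degree_add_of_lt hlt⟩

/-- The `neglex` leading term of `h_d(x_q : q ≤ m)` is `x_m^d`. -/
theorem leading_coeff_completeSeries [Nontrivial A] (m : Fin n) (d : ℕ) :
    (neglex n).Monic (PowerSeries.coeff d (completeSeries A m)) ∧
      (neglex n).degree (PowerSeries.coeff d (completeSeries A m)) = Finsupp.single m d := by
  classical
  -- Splitting off the factor of `x_m` expands `h_d` in powers of `x_m`. All terms but `x_m^d` have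
  -- a smaller exponent of `x_m`, and no later variable occurs.
  let P : PowerSeries (MvPolynomial (Fin n) A) := ∏ q ∈ Finset.Iio m, geomSeries (X q)
  have hP : ∀ e, PowerSeries.coeff e P ∈ supported A (Set.Iio m) := fun e =>
    coeff_prod_geomSeries_mem _ _ _
      (fun i hi => X_mem_supported.2 (by simpa using hi)) e
  have hP0 : PowerSeries.coeff 0 P = 1 := by
    simp [P, map_prod, geomSeries, ← PowerSeries.coeff_zero_eq_constantCoeff_apply,
      PowerSeries.coeff_mk]
  have hX : ∀ a, PowerSeries.coeff a (geomSeries (X m : MvPolynomial (Fin n) A)) =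
      monomial (Finsupp.single m a) 1 := fun a => by
    rw [geomSeries, PowerSeries.coeff_mk, X_pow_eq_monomial]
  have hsum : PowerSeries.coeff d (completeSeries A m) = monomial (Finsupp.single m d) 1 +
      ∑ p ∈ (Finset.HasAntidiagonal.antidiagonal d).erase (d, 0),
        monomial (Finsupp.single m p.1) 1 * PowerSeries.coeff p.2 P := by
    rw [completeSeries, ← Finset.Iio_insert, Finset.prod_insert (by simp), PowerSeries.coeff_mul,
      ← Finset.add_sum_erase _ _ (a := (d, 0)) (by simp)]
    congr 1
    · change _ * PowerSeries.coeff 0 P = _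
      rw [hP0, mul_one, hX]
    · exact Finset.sum_congr rfl fun p _ => by rw [hX]
  rw [hsum]
  refine leading_add_of_support_lt _ (MonomialOrder.monic_monomial_one)
    (by rw [MonomialOrder.degree_monomial, if_neg one_ne_zero]) fun b hb => ?_
  obtain ⟨p, hp, hb⟩ := Finset.mem_biUnion.1 (support_sum hb)
  rw [Finset.mem_erase, Finset.HasAntidiagonal.mem_antidiagonal] at hp
  obtain ⟨u, hu, c, hc, rfl⟩ := Finset.mem_add.1 (support_mul _ _ hb)
  obtain rfl := Finset.mem_singleton.1 (support_monomial_subset hu)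
  have hc0 : ∀ q, m ≤ q → c q = 0 := by
    intro q hq
    by_contra h
    have h1 : q ∈ (PowerSeries.coeff p.2 P).vars :=
      (mem_vars_iff_mem_support _).2 ⟨c, hc, Finsupp.mem_support_iff.2 h⟩
    exact absurd (mem_supported.1 (hP p.2) h1) (not_lt.2 hq)
  rw [neglex_lt_iff]
  refine ⟨m, ?_, fun j hj => ?_⟩
  · rw [Finsupp.add_apply, Finsupp.single_eq_same, Finsupp.single_eq_same, hc0 m le_rfl]
    rcases p with ⟨p1, p2⟩
    simp only [ne_eq, Prod.mk.injEq, not_and] at hp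
    simp only
    have := hp.1
    omega
  · rw [Finsupp.add_apply, hc0 j hj.le, Finsupp.single_eq_of_ne hj.ne',
      Finsupp.single_eq_of_ne hj.ne', add_zero]

theorem sum_single_apply {t : Fin r → Fin n} (ht : StrictMono t) (c : Fin r → ℕ) (i : Fin r) :
    (∑ j, Finsupp.single (t j) (c j)) (t i) = c i := by
  rw [Finsupp.finsetSum_apply, Finset.sum_eq_single i]
  · simp
  · intro j _ hj
    exact Finsupp.single_eq_of_ne (ht.injective.ne hj.symm)
  · simp

/-- The largest index moved by `σ` must move down, since all larger ones are fixed. There the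
exponent drops, and `0 < l` keeps the drop strict under truncated subtraction. -/
theorem sum_single_lt {t : Fin r → Fin n} (ht : StrictMono t) {l : Fin r → ℕ}
    (hl : ∀ i, 0 < l i) {σ : Equiv.Perm (Fin r)} (hσ : σ ≠ 1) :
    (∑ i, Finsupp.single (t i) (l i + (σ i : ℕ) - i)) ≺[neglex n]
      ∑ i, Finsupp.single (t i) (l i) := by
  have hne : (Finset.univ.filter fun i => σ i ≠ i).Nonempty := by
    by_contra h
    rw [Finset.not_nonempty_iff_eq_empty, Finset.filter_eq_empty_iff] at h
    exact hσ (Equiv.ext fun i => by simpa using h (Finset.mem_univ i))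
  obtain ⟨i₀, hi₀, hmax⟩ := Finset.exists_max_image _ id hne
  simp only [Finset.mem_filter, Finset.mem_univ, true_and, id] at hi₀ hmax
  have hfix : ∀ i, i₀ < i → σ i = i := fun i hi => by
    by_contra h
    exact absurd (hmax i h) (not_le.2 hi)
  have hlt : σ i₀ < i₀ := by
    rcases lt_trichotomy (σ i₀) i₀ with h | h | h
    · exact h
    · exact absurd h hi₀
    · exact absurd (σ.injective (hfix _ h)) hi₀
  rw [neglex_lt_iff]
  refine ⟨t i₀, ?_, fun q hq => ?_⟩
  · rw [sum_single_apply ht, sum_single_apply ht]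
    have := hl i₀
    rw [Fin.lt_def] at hlt
    omega
  · rw [Finsupp.finsetSum_apply, Finsupp.finsetSum_apply]
    refine Finset.sum_congr rfl fun i _ => ?_
    by_cases h : t i = q
    · subst h
      rw [hfix i (ht.lt_iff_lt.1 hq), Nat.add_sub_cancel]
    · rw [Finsupp.single_eq_of_ne (Ne.symm h), Finsupp.single_eq_of_ne (Ne.symm h)]

/-- The `neglex` leading term of a flagged Schur polynomial is `∏ x_{t_i}^{l_i}`. -/
theorem leading_det_flaggedMatrix [Nontrivial A] {t : Fin r → Fin n} (ht : StrictMono t)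
    {l : Fin r → ℕ} (hl : ∀ i, 0 < l i) :
    (neglex n).Monic (flaggedMatrix A t l).det ∧
      (neglex n).degree (flaggedMatrix A t l).det = ∑ i, Finsupp.single (t i) (l i) := by
  classical
  have hentry : ∀ i j : Fin r, flaggedMatrix A t l i j = if (i : ℕ) ≤ l i + j then
      PowerSeries.coeff (l i + j - i) (completeSeries A (t i)) else 0 := fun i j => by
    rw [flaggedMatrix, Matrix.of_apply, PowerSeries.coeff_X_pow_mul']
  have hdiag : ∀ i, flaggedMatrix A t l i i =
      PowerSeries.coeff (l i) (completeSeries A (t i)) := fun i => by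
    rw [hentry, if_pos (Nat.le_add_left _ _), Nat.add_sub_cancel]
  -- An entry with `i > l_i + j` is zero, of degree zero, so the bound survives truncation of the
  -- exponent.
  have hdeg : ∀ i j : Fin r, (neglex n).degree (flaggedMatrix A t l i j) ≼[neglex n]
      Finsupp.single (t i) (l i + (j : ℕ) - i) := fun i j => by
    rw [hentry]
    split_ifs
    · rw [(leading_coeff_completeSeries _ _).2]
    · rw [MonomialOrder.degree_zero, map_zero]
      exact (neglex n).zero_le _
  rw [← Matrix.det_transpose, Matrix.det_apply,
    ← Finset.add_sum_erase _ _ (Finset.mem_univ (1 : Equiv.Perm (Fin r))),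
    Equiv.Perm.sign_one, one_smul]
  simp only [Matrix.transpose_apply, Equiv.Perm.one_apply, hdiag]
  refine leading_add_of_support_lt _
    (MonomialOrder.Monic.prod fun i _ => (leading_coeff_completeSeries _ _).1) ?_ fun b hb => ?_
  · rw [MonomialOrder.degree_prod_of_regular]
    · exact Finset.sum_congr rfl fun i _ => (leading_coeff_completeSeries _ _).2
    · intro i _
      rw [(leading_coeff_completeSeries (A := A) _ _).1.leadingCoeff_eq_one]
      exact isRegular_one
  · obtain ⟨σ, hσ, hb⟩ := Finset.mem_biUnion.1 (support_sum hb)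
    refine lt_of_le_of_lt ?_ (sum_single_lt ht hl (Finset.ne_of_mem_erase hσ))
    have hb' : b ∈ (∏ i, flaggedMatrix A t l i (σ i)).support := by
      rw [mem_support_iff] at hb ⊢
      intro h
      apply hb
      rw [Units.smul_def, coeff_smul, h, smul_zero]
    refine ((neglex n).le_degree hb').trans ((neglex n).degree_prod_le.trans ?_)
    rw [map_sum, map_sum]
    exact Finset.sum_le_sum fun i _ => hdeg i (σ i)

theorem mon_eq_monomial (a : Fin n → ℕ) :
    mon A a = monomial (Finsupp.equivFunOnFinite.symm a) 1 := by
  rw [monomial_eq, C_1, one_mul, Finsupp.prod_fintype _ _ (fun _ => pow_zero _), mon]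
  rfl

end LeadingTerm

/-! ### Skip sequences and their Demazure characters -/

section Skip

variable {n r : ℕ}

theorem card_filter_lt_orderEmbOfFin (S : Finset (Fin n)) (h : S.card = r) (j : Fin r) :
    (S.filter (· < S.orderEmbOfFin h j)).card = j := by
  have : S.filter (· < S.orderEmbOfFin h j) = (Finset.Iio j).map (S.orderEmbOfFin h).toEmbedding := by
    ext x
    simp only [Finset.mem_filter, Finset.mem_map, Finset.mem_Iio]
    constructor
    · rintro ⟨hx, hlt⟩
      have hx' : x ∈ Set.range (S.orderEmbOfFin h) := by
        rw [Finset.range_orderEmbOfFin]; exact hx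
      obtain ⟨i, rfl⟩ := hx'
      exact ⟨i, (S.orderEmbOfFin h).lt_iff_lt.1 hlt, rfl⟩
    · rintro ⟨i, hi, rfl⟩
      exact ⟨S.orderEmbOfFin_mem h i, (S.orderEmbOfFin h).lt_iff_lt.2 hi⟩
  rw [this, Finset.card_map, Fin.card_Iio]

variable (S : Finset (Fin n)) (h : S.card = r)

/-- The positions of the non-zero entries of `rev(γ(S))`. -/
noncomputable def skipFlag (i : Fin r) : Fin n := (S.orderEmbOfFin h i.rev).rev

/-- The non-zero entries of `rev(γ(S))`. -/
noncomputable def skipParts (i : Fin r) : ℕ := S.orderEmbOfFin h i.rev + 1 - i.rev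

theorem strictMono_skipFlag : StrictMono (skipFlag S h) := fun _ _ hij =>
  Fin.rev_lt_rev.2 ((S.orderEmbOfFin h).lt_iff_lt.2 (Fin.rev_lt_rev.2 hij))

theorem skipParts_pos (i : Fin r) : 0 < skipParts S h i := by
  have := val_add_le_of_strictMono (S.orderEmbOfFin h).strictMono
    (i := ⟨0, i.pos⟩) (j := i.rev) (Fin.le_def.2 (Nat.zero_le _))
  simp only [skipParts] at *
  omega

/-- The differences `s_j - j` weakly increase with `j`, and the reversal turns this around. -/
theorem antitone_skipParts : Antitone (skipParts S h) := fun _ _ hij => by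
  have := val_add_le_of_strictMono (S.orderEmbOfFin h).strictMono (Fin.rev_le_rev.2 hij)
  simp only [skipParts] at *
  omega

theorem revSeq_skipSeq_skipFlag (i : Fin r) :
    revSeq (skipSeq S) (skipFlag S h i) = skipParts S h i := by
  rw [revSeq, skipFlag, Fin.rev_rev, skipSeq, if_pos (S.orderEmbOfFin_mem h _),
    card_filter_lt_orderEmbOfFin, skipParts]

theorem revSeq_skipSeq_eq_zero (p : Fin n) (hp : ∀ i, skipFlag S h i ≠ p) :
    revSeq (skipSeq S) p = 0 := by
  rw [revSeq, skipSeq, if_neg]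
  intro hmem
  have hx : p.rev ∈ Set.range (S.orderEmbOfFin h) := by
    rw [Finset.range_orderEmbOfFin]; exact hmem
  obtain ⟨i, hi⟩ := hx
  exact hp i.rev (by rw [skipFlag, Fin.rev_rev, hi, Fin.rev_rev])

/-- This is the numerical hypothesis of `det_flaggedMatrix_mem`. The element of `S` cancels between
the part and its reversed position; truncated subtraction could only enlarge the right side. -/
theorem le_skipParts_add (i : Fin r) :
    n + i ≤ skipParts S h i + r - 1 + skipFlag S h i := by
  have := (S.orderEmbOfFin h i.rev).2
  simp only [skipParts, skipFlag, Fin.val_rev]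
  omega

theorem demazure_skip_eq {A : Type*} [CommRing A] [IsDomain A] :
    demazure A (revSeq (skipSeq S)) = (flaggedMatrix A (skipFlag S h) (skipParts S h)).det :=
  demazure_eq_det_flaggedMatrix (strictMono_skipFlag S h) (skipParts_pos S h)
    (antitone_skipParts S h) (revSeq_skipSeq_skipFlag S h) (revSeq_skipSeq_eq_zero S h)

theorem sum_single_skip :
    ∑ i, Finsupp.single (skipFlag S h i) (skipParts S h i) =
      Finsupp.equivFunOnFinite.symm (revSeq (skipSeq S)) := by
  ext p
  rw [Finsupp.equivFunOnFinite_symm_apply_apply]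
  by_cases hp : ∃ i, skipFlag S h i = p
  · obtain ⟨i, rfl⟩ := hp
    rw [sum_single_apply (strictMono_skipFlag S h), revSeq_skipSeq_skipFlag]
  · push Not at hp
    rw [revSeq_skipSeq_eq_zero S h p hp, Finsupp.finsetSum_apply]
    exact Finset.sum_eq_zero fun i _ => Finsupp.single_eq_of_ne (hp i).symm

theorem leading_demazure_skip {A : Type*} [CommRing A] [IsDomain A] :
    (neglex n).Monic (demazure A (revSeq (skipSeq S))) ∧
      (neglex n).degree (demazure A (revSeq (skipSeq S))) =
        Finsupp.equivFunOnFinite.symm (revSeq (skipSeq S)) := by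
  rw [demazure_skip_eq S rfl, ← sum_single_skip S rfl]
  exact leading_det_flaggedMatrix (strictMono_skipFlag S rfl) (skipParts_pos S rfl)

theorem leadingTerm_demazure_skip {A : Type*} [CommRing A] [IsDomain A] :
    (neglex n).leadingTerm (demazure A (revSeq (skipSeq S))) = mon A (revSeq (skipSeq S)) := by
  obtain ⟨h1, h2⟩ := leading_demazure_skip S (A := A)
  rw [MonomialOrder.leadingTerm, h1.leadingCoeff_eq_one, h2, mon_eq_monomial]

theorem demazure_skip_mem {A : Type*} [CommRing A] [IsDomain A] {k : ℕ}
    (hS : S.card = n - k + 1) : demazure A (revSeq (skipSeq S)) ∈ elemIdeal A n k := by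
  rw [demazure_skip_eq S hS]
  refine det_flaggedMatrix_mem _ (fun d h1 h2 => ?_) (Nat.succ_pos _) (le_skipParts_add S hS)
  exact Ideal.subset_span ⟨d, h1, h2, rfl⟩

end Skip

/-! ### A sequence fits under a staircase or dominates a reversed skip sequence -/

section Combinatorics

variable {n : ℕ}

/-- Scan the positions in order and accept one when its value is at most the number accepted so far:
the accepted positions can carry the bounds `0, 1, 2, …`. -/
theorem exists_greedy (b : Fin n → ℕ) :
    ∃ C : Finset (Fin n), ∀ p, p ∈ C ↔ b p ≤ (C.filter (· < p)).card := by
  classical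
  suffices H : ∀ m, m ≤ n → ∃ C : Finset (Fin n), ∀ p : Fin n, (p : ℕ) < m →
      (p ∈ C ↔ b p ≤ (C.filter (· < p)).card) by
    obtain ⟨C, hC⟩ := H n le_rfl
    exact ⟨C, fun p => hC p p.2⟩
  intro m
  induction m with
  | zero => exact fun _ => ⟨∅, fun p hp => absurd hp (Nat.not_lt_zero _)⟩
  | succ m ih =>
    intro hm
    obtain ⟨C, hC⟩ := ih (Nat.le_of_succ_le hm)
    let q : Fin n := ⟨m, hm⟩
    -- The induction hypothesis says nothing about `q ∈ C`, so a rejection has to erase `q`.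
    let D : Finset (Fin n) :=
      if b q ≤ (C.filter (· < q)).card then insert q C else C.erase q
    have hmem : ∀ p, p ≠ q → (p ∈ D ↔ p ∈ C) := by
      intro p hp
      simp only [D]
      split_ifs <;> simp [hp]
    have hq : q ∈ D ↔ b q ≤ (C.filter (· < q)).card := by
      simp only [D]
      split_ifs with h <;> simp [h]
    have hfilter : ∀ p : Fin n, p ≤ q → D.filter (· < p) = C.filter (· < p) := by
      intro p hp
      ext x
      simp only [Finset.mem_filter]
      exact and_congr_left fun hx => hmem x (hx.trans_le hp).ne
    refine ⟨D, fun p hp => ?_⟩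
    have hpq : p ≤ q := Fin.le_def.2 (Nat.lt_succ_iff.1 hp)
    rw [hfilter p hpq]
    rcases eq_or_lt_of_le hpq with h | h
    · rw [h, hq]
    · rw [hmem p h.ne]
      exact hC p (Fin.lt_def.1 h)

/-- Deleting maxima leaves the first `r` elements and does not disturb the counts below them. -/
theorem exists_initial_subset (B : Finset (Fin n)) {r : ℕ} (hr : r ≤ B.card) :
    ∃ S ⊆ B, S.card = r ∧ ∀ p ∈ S, S.filter (· < p) = B.filter (· < p) := by
  refine Nat.le_induction (m := r) (P := fun m _ => ∀ B : Finset (Fin n), B.card = m →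
    ∃ S ⊆ B, S.card = r ∧ ∀ p ∈ S, S.filter (· < p) = B.filter (· < p))
    (fun B hB => ⟨B, subset_rfl, hB, fun _ _ => rfl⟩) (fun m _ ih B hB => ?_) _ hr B rfl
  have hne : B.Nonempty := Finset.card_pos.1 (by omega)
  obtain ⟨S, hS, hcard, h⟩ := ih (B.erase (B.max' hne))
    (by rw [Finset.card_erase_of_mem (B.max'_mem hne), hB, Nat.add_sub_cancel])
  refine ⟨S, hS.trans (Finset.erase_subset _ _), hcard, fun p hp => ?_⟩
  rw [h p hp]
  ext x
  simp only [Finset.mem_filter, Finset.mem_erase]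
  refine ⟨fun hx => ⟨hx.1.2, hx.2⟩, fun hx => ⟨⟨fun e => ?_, hx.1⟩, hx.2⟩⟩
  have := B.le_max' p (Finset.mem_of_mem_erase (hS hp))
  exact absurd hx.2 (not_lt.2 (e ▸ this))

/-- Along the reversal of `C` the entries read `0, 1, …, k-1` from the right, hence `k-1, …, 0` from
the left. -/
theorem isStaircase_of_card {k : ℕ} (C : Finset (Fin n)) (hC : C.card = k) :
    IsStaircase n k fun p =>
      if p.rev ∈ C then (C.filter (· < p.rev)).card else k - 1 := by
  have hC' : Cᶜ.card = n - k := by rw [Finset.card_compl, Fintype.card_fin, hC]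
  have hrange : ∀ (D : Finset (Fin n)) (m : ℕ) (hD : D.card = m) (p : Fin n),
      p ∈ Set.range (fun i : Fin m => (D.orderEmbOfFin hD i.rev).rev) ↔ p.rev ∈ D := by
    intro D m hD p
    constructor
    · rintro ⟨i, rfl⟩
      rw [Fin.rev_rev]
      exact D.orderEmbOfFin_mem hD _
    · intro hp
      have : p.rev ∈ Set.range (D.orderEmbOfFin hD) := by
        rw [Finset.range_orderEmbOfFin]; exact hp
      obtain ⟨i, hi⟩ := this
      exact ⟨i.rev, by simp only [Fin.rev_rev, hi]⟩
  refine ⟨fun i => (C.orderEmbOfFin hC i.rev).rev,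
    fun i => (Cᶜ.orderEmbOfFin hC' i.rev).rev,
    strictMono_skipFlag C hC, strictMono_skipFlag Cᶜ hC', ?_, fun i => ?_, fun j => ?_⟩
  · have : Set.range (fun i : Fin (n - k) => (Cᶜ.orderEmbOfFin hC' i.rev).rev) =
        (Set.range fun i : Fin k => (C.orderEmbOfFin hC i.rev).rev)ᶜ := by
      ext p
      rw [Set.mem_compl_iff, hrange, hrange, Finset.mem_compl]
    rw [this]
    exact isCompl_compl
  · simp only [Fin.rev_rev]
    rw [if_pos (C.orderEmbOfFin_mem hC _), card_filter_lt_orderEmbOfFin, Fin.val_rev]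
    omega
  · simp only [Fin.rev_rev]
    rw [if_neg (Finset.mem_compl.1 (Cᶜ.orderEmbOfFin_mem hC' _))]

/-- Run the greedy choice from the right. With `k` accepted positions, the first `k` of them define
a staircase above `a`. Otherwise at least `n-k+1` are rejected, and the first `n-k+1` rejected ones
form `S`. -/
theorem exists_skip_le_of_notMem_substaircase {k : ℕ} (hkn : k ≤ n) {a : Fin n → ℕ}
    (hak : ∀ p, a p < k) (ha : a ∉ substaircase n k) :
    ∃ S : Finset (Fin n), S.card = n - k + 1 ∧ revSeq (skipSeq S) ≤ a := by
  obtain ⟨C, hC⟩ := exists_greedy fun p => a p.rev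
  have hk : C.card < k := by
    by_contra! hcard
    obtain ⟨D, hDC, hD, hfilter⟩ := exists_initial_subset C hcard
    refine ha ⟨_, isStaircase_of_card D hD, fun p => ?_⟩
    simp only
    split_ifs with hp
    · rw [hfilter _ hp]
      simpa using (hC p.rev).1 (hDC hp)
    · exact Nat.le_sub_one_of_lt (hak p)
  obtain ⟨S, hSC, hS, hfilter⟩ := exists_initial_subset Cᶜ (r := n - k + 1) (by
    rw [Finset.card_compl, Fintype.card_fin]
    omega)
  refine ⟨S, hS, fun p => ?_⟩
  rw [revSeq, skipSeq]
  split_ifs with hp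
  · have h1 := (hC p.rev).not.1 (Finset.mem_compl.1 (hSC hp))
    rw [hfilter _ hp]
    -- Rejection means that the value exceeds the number accepted before, which is the position
    -- minus the number rejected before; the excess of one is the `+ 1` of the skip sequence.
    have h2 : (C.filter (· < p.rev)).card + (Cᶜ.filter (· < p.rev)).card = p.rev := by
      rw [← Finset.card_union_of_disjoint, ← Finset.filter_union, Finset.union_compl]
      · rw [show Finset.univ.filter (· < p.rev) = Finset.Iio p.rev by ext; simp, Fin.card_Iio]
      · exact Finset.disjoint_filter_filter disjoint_compl_right
    simp only [Fin.rev_rev] at h1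
    exact Nat.sub_le_iff_le_add.2 (by omega)
  · exact Nat.zero_le _

end Combinatorics

/-! ### Initial ideals and standard monomials -/

section Standard

variable {n : ℕ}

/-- A monomial lies in a monomial ideal iff a generator divides it; the final `≤` is componentwise,
not the term order. -/
theorem monomial_mem_initialIdeal {I : Ideal (MvPolynomial (Fin n) ℂ)} {a : Fin n →₀ ℕ} :
    monomial a 1 ∈ initialIdeal I ↔ ∃ f ∈ I, f ≠ 0 ∧ (neglex n).degree f ≤ a := by
  have : {m | ∃ f ∈ I, f ≠ 0 ∧ m = initialMonomial f} =
      (fun s => monomial s (1 : ℂ)) '' {s | ∃ f ∈ I, f ≠ 0 ∧ s = (neglex n).degree f} := by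
    ext m
    constructor
    · rintro ⟨f, hf, h0, rfl⟩
      exact ⟨_, ⟨f, hf, h0, rfl⟩, rfl⟩
    · rintro ⟨_, ⟨f, hf, h0, rfl⟩, rfl⟩
      exact ⟨f, hf, h0, rfl⟩
  rw [initialIdeal, this, mem_ideal_span_monomial_image]
  simp only [support_monomial, one_ne_zero, if_false, Finset.mem_singleton, forall_eq]
  constructor
  · rintro ⟨_, ⟨f, hf, h0, rfl⟩, h⟩
    exact ⟨f, hf, h0, h⟩
  · rintro ⟨f, hf, h0, h⟩
    exact ⟨_, ⟨f, hf, h0, rfl⟩, h⟩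

theorem standardMonomials_eq_image (I : Ideal (MvPolynomial (Fin n) ℂ)) :
    standardMonomials I = (fun s => monomial s (1 : ℂ)) ''
      {a | monomial a 1 ∉ initialIdeal I} := by
  ext m
  constructor
  · rintro ⟨⟨a, rfl⟩, h⟩
    rw [mon_eq_monomial] at h ⊢
    exact ⟨_, h, rfl⟩
  · rintro ⟨a, h, rfl⟩
    exact ⟨⟨a, by rw [mon_eq_monomial]; simp⟩, h⟩

theorem span_standardMonomials_quotient (I : Ideal (MvPolynomial (Fin n) ℂ)) :
    Submodule.span ℂ (Ideal.Quotient.mk I '' standardMonomials I) =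
      (⊤ : Submodule ℂ (MvPolynomial (Fin n) ℂ ⧸ I)) := by
  have himg : Ideal.Quotient.mk I '' standardMonomials I =
      (Ideal.Quotient.mkₐ ℂ I).toLinearMap '' standardMonomials I := rfl
  rw [himg, Submodule.span_image, eq_top_iff]
  rintro x -
  obtain ⟨f, rfl⟩ := Ideal.Quotient.mk_surjective x
  -- Dividing by all non-zero elements of `I` at once avoids choosing a Gröbner basis.
  obtain ⟨g, ρ, hf, -, hρ⟩ := (neglex n).div_set (B := {b | b ∈ I ∧ b ≠ 0})
    (fun b hb => isUnit_iff_ne_zero.2 (MonomialOrder.leadingCoeff_ne_zero_iff.2 hb.2)) f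
  refine ⟨ρ, ?_, ?_⟩
  · rw [standardMonomials_eq_image, ← restrictSupport_eq_span, SetLike.mem_coe,
      mem_restrictSupport_iff]
    intro c hc h
    obtain ⟨b, hb, h0, hle⟩ := monomial_mem_initialIdeal.1 h
    exact hρ c hc b ⟨hb, h0⟩ hle
  · refine Ideal.Quotient.eq.2 ?_
    rw [hf, ← neg_mem_iff, neg_sub, add_sub_cancel_right, Finsupp.linearCombination_apply]
    exact I.sum_mem fun b _ => I.mul_mem_left _ b.2.1

theorem linearIndependent_standardMonomials_quotient (I : Ideal (MvPolynomial (Fin n) ℂ)) :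
    LinearIndependent ℂ fun m : standardMonomials I =>
      (Ideal.Quotient.mk I (m : MvPolynomial (Fin n) ℂ) : MvPolynomial (Fin n) ℂ ⧸ I) := by
  have hli : LinearIndependent ℂ fun m : standardMonomials I => (m : MvPolynomial (Fin n) ℂ) := by
    have h : LinearIndepOn ℂ id (Set.range (basisMonomials (Fin n) ℂ)) :=
      (basisMonomials (Fin n) ℂ).linearIndependent.linearIndepOn_id
    refine LinearIndepOn.mono (v := id) h ?_
    rw [standardMonomials_eq_image]
    rintro _ ⟨a, -, rfl⟩
    exact ⟨a, rfl⟩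
  -- A non-zero combination of standard monomials lying in `I` would have a standard leading
  -- monomial, yet that monomial is in the initial ideal.
  refine LinearIndependent.map (f := (Ideal.Quotient.mkₐ ℂ I).toLinearMap) hli ?_
  rw [Subtype.range_coe, Submodule.disjoint_def]
  intro f hf hI
  have hI' : f ∈ I := Ideal.Quotient.eq_zero_iff_mem.1 hI
  rw [standardMonomials_eq_image, ← restrictSupport_eq_span, mem_restrictSupport_iff] at hf
  by_contra h0
  exact hf ((neglex n).degree_mem_support h0)
    (monomial_mem_initialIdeal.2 ⟨f, hI', h0, le_rfl⟩)

theorem elemIdeal_le_idealI (k : ℕ) : elemIdeal ℂ n k ≤ idealI n k :=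
  Ideal.span_mono Set.subset_union_left

theorem standardMonomials_subset_substaircaseMonomials {k : ℕ} (hkn : k ≤ n) :
    standardMonomials (idealI n k) ⊆ substaircaseMonomials n k := by
  rintro _ ⟨⟨a, rfl⟩, h⟩
  refine ⟨a, ?_, rfl⟩
  rw [mon_eq_monomial] at h
  by_contra ha
  have hak : ∀ p, a p < k := by
    intro p
    by_contra! hp
    refine h (monomial_mem_initialIdeal.2 ⟨X p ^ k,
      Ideal.subset_span (Or.inr ⟨p, rfl⟩), pow_ne_zero _ (X_ne_zero p), ?_⟩)
    rw [X_pow_eq_monomial, MonomialOrder.degree_monomial, if_neg one_ne_zero,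
      Finsupp.single_le_iff]
    exact hp
  obtain ⟨S, hS, hle⟩ := exists_skip_le_of_notMem_substaircase hkn hak ha
  obtain ⟨h1, h2⟩ := leading_demazure_skip S (A := ℂ)
  refine h (monomial_mem_initialIdeal.2 ⟨_, elemIdeal_le_idealI k (demazure_skip_mem S hS),
    h1.ne_zero, ?_⟩)
  rw [h2]
  exact hle

end Standard

end Substaircase

theorem proposition2p2 (n k : ℕ) (hk : 1 ≤ k) (hkn : k ≤ n) :
    -- the substaircase monomials span `R_{n,k}`
    Submodule.span ℂ (Ideal.Quotient.mk (idealI n k) '' substaircaseMonomials n k) =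
        (⊤ : Submodule ℂ (ringR n k)) ∧
    -- the standard monomials descend to a basis of `R_{n,k}` ...
    (LinearIndependent ℂ
        (fun m : standardMonomials (idealI n k) =>
          (Ideal.Quotient.mk (idealI n k) (m : MvPolynomial (Fin n) ℂ) : ringR n k)) ∧
      Submodule.span ℂ (Ideal.Quotient.mk (idealI n k) '' standardMonomials (idealI n k)) =
        (⊤ : Submodule ℂ (ringR n k))) ∧
    -- ... and are contained in the set of substaircase monomials
    standardMonomials (idealI n k) ⊆ substaircaseMonomials n k ∧
    -- the Demazure characters of reversed skip sequences lie in `⟨e_n, …, e_{n-k+1}⟩`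
    -- and have the `neglex` leading term `x^{rev(γ(S))}`
    ∀ S : Finset (Fin n), S.card = n - k + 1 →
      demazure ℤ (revSeq (skipSeq S)) ∈ elemIdeal ℤ n k ∧
      demazure ℂ (revSeq (skipSeq S)) ∈ elemIdeal ℂ n k ∧
      (neglex n).leadingTerm (demazure ℂ (revSeq (skipSeq S))) = mon ℂ (revSeq (skipSeq S)) := by
  have hspan := span_standardMonomials_quotient (idealI n k)
  have hsub := standardMonomials_subset_substaircaseMonomials hkn
  refine ⟨?_, ⟨linearIndependent_standardMonomials_quotient _, hspan⟩, hsub, fun S hS =>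
    ⟨demazure_skip_mem S hS, demazure_skip_mem S hS, leadingTerm_demazure_skip S⟩⟩
  rw [eq_top_iff, ← hspan]
  exact Submodule.span_mono (Set.image_mono hsub)
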